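/- \textbf{Theorem (Bernstein).} Let $f:\mathbb{R}^2\to\mathbb{R}$ be a smooth ($C^\infty$) function, and assume that its graph $\Sigma=\{(x,y,z)\in\mathbb{R}^3 : z=f(x,y)\}$ is a strictly saddle surface, that is, $\Sigma$ is a smooth surface whose Gauss curvature is negative at each point. Then $f$ is not bounded; that is, there is no constant $C$ such that $|f(x,y)|\le C$ for all $(x,y)\in\mathbb{R}^2$. Here a smooth surface is a connected set $\Sigma\subset\mathbb{R}^3$ that near each of its points is, in some rectangular coordinate system, the graph of a smooth function defined on an open subset of the plane. The Gauss curvature of $\Sigma$ at $p$ is the product $k_1k_2$ of its principal curvatures at $p$. These are the eigenvalues of the Hessian matrix $\begin{pmatrix}h_{xx}&h_{xy}\\h_{xy}&h_{yy}\end{pmatrix}(0,0)$, where $z=h(x,y)$ is the local representation of $\Sigma$ as a graph in rectangular coordinates with origin $p$ whose $(x,y)$-plane is the tangent plane of $\Sigma$ at $p$; the product $k_1k_2$ does not depend on the choice of such coordinates. -/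

import Mathlib

open scoped ContDiff Topology

noncomputable section

/-- The Euclidean plane. -/
abbrev Plane : Type := EuclideanSpace ℝ (Fin 2)

/-- Euclidean three-space. -/
abbrev Space : Type := EuclideanSpace ℝ (Fin 3)

/-- The point with coordinates `(x, y, z)`, where `q = (x, y)`, in the rectangular coordinate system
with origin `o` and axes directed along the orthonormal basis `e`. -/
def coordPoint (o : Space) (e : OrthonormalBasis (Fin 3) ℝ Space) (q : Plane) (z : ℝ) : Space :=
  o + q 0 • e 0 + q 1 • e 1 + z • e 2

/-- Near `p`, the set `S` is the graph `z = h(x, y)` of a smooth function `h` defined on the open set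
`V` of the `(x, y)`-plane, in the coordinate system with origin `o` and axes `e`. -/
def IsLocalGraph (S : Set Space) (p o : Space) (e : OrthonormalBasis (Fin 3) ℝ Space)
    (V : Set Plane) (h : Plane → ℝ) : Prop :=
  IsOpen V ∧ ContDiffOn ℝ ∞ h V ∧
    ∃ U ∈ 𝓝 p, U ∩ S = (fun q => coordPoint o e q (h q)) '' V

/-- A smooth (regular, embedded) surface in space, without boundary: a connected set that near each
of its points is the graph of a smooth function in an appropriate coordinate system. -/
def IsSmoothSurface (S : Set Space) : Prop :=
  IsConnected S ∧ ∀ p ∈ S, ∃ o e V h, IsLocalGraph S p o e V h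

/-- Tangent-normal coordinates of `S` at `p`: the origin is `p`, the set `S` is near `p` the graph
`z = h(x, y)` of a smooth function, and the tangent plane at `p` is the `(x, y)`-plane. -/
def IsTangentNormalGraph (S : Set Space) (p : Space) (e : OrthonormalBasis (Fin 3) ℝ Space)
    (V : Set Plane) (h : Plane → ℝ) : Prop :=
  IsLocalGraph S p p e V h ∧ (0 : Plane) ∈ V ∧ h 0 = 0 ∧ fderiv ℝ h 0 = 0

/-- The partial derivative of `h` in the `i`-th coordinate. -/
def partialDeriv (i : Fin 2) (h : Plane → ℝ) (q : Plane) : ℝ :=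
  fderiv ℝ h q (EuclideanSpace.single i 1)

/-- The Hessian matrix of `h` at `q`. -/
def hessianMatrix (h : Plane → ℝ) (q : Plane) : Matrix (Fin 2) (Fin 2) ℝ :=
  Matrix.of fun i j => partialDeriv j (partialDeriv i h) q

/-- `k₁ ≤ k₂` are the principal curvatures of `S` at `p`: the diagonal entries of the Hessian matrix
at the origin, in tangent-normal coordinates at `p` rotated so that this matrix is diagonal.
(For one of the two choices of the unit normal; the other choice replaces them by `-k₂ ≤ -k₁`.) -/
def HasPrincipalCurvaturesAt (S : Set Space) (p : Space) (k₁ k₂ : ℝ) : Prop :=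
  k₁ ≤ k₂ ∧ ∃ e V h, IsTangentNormalGraph S p e V h ∧
    hessianMatrix h 0 = Matrix.diagonal ![k₁, k₂]

/-- `K` is the Gauss curvature of `S` at `p`: the product of the principal curvatures. -/
def HasGaussCurvatureAt (S : Set Space) (p : Space) (K : ℝ) : Prop :=
  ∃ k₁ k₂, HasPrincipalCurvaturesAt S p k₁ k₂ ∧ K = k₁ * k₂

/-- A strictly saddle surface: a smooth surface with negative Gauss curvature at each point. -/
def IsStrictlySaddle (S : Set Space) : Prop :=
  IsSmoothSurface S ∧ ∀ p ∈ S, ∃ K, HasGaussCurvatureAt S p K ∧ K < 0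

/-- The graph `z = f(x, y)` in space. -/
def graphSurface (f : Plane → ℝ) : Set Space :=
  {P | P 2 = f !₂[P 0, P 1]}

end

/-! Negative curvature makes the second derivative of f indefinite at every point
(`exists_fderiv_fderiv_eq_mul_hessianMatrix`), so f minus a linear function never has a local
extremum. Suppose |f| ≤ C. Pick q with nonzero gradient and let g be f minus its tangent affine
function at q.

Since the affine function is not constant, {g > 0} contains a half-plane. A component of {g > 0}
missing that half-plane would lie in a strip, with g bounded above on it and not positive on its
boundary; the maximum principle `nonpos_of_subset_strip` excludes this. So {g > 0} is connected, and
so is {g < 0} by symmetry (`isPreconnected_pos_sub_affine`).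

Near q, however, g is positive on both arms of one segment through q and negative on both arms of
another. Joining opposite arms inside the two disjoint connected sets is impossible in the plane
(`not_disjoint_of_cross`). This is proved by comparing branches of the logarithm. -/

open Set Filter

/-! ### Plane topology: connected sets and a cross -/

/-- A continuous function on a preconnected set is constant if its exponential is. -/
theorem IsPreconnected.eq_of_exp_eq {X : Type*} [TopologicalSpace X] {S : Set X}
    (hS : IsPreconnected S) {φ : X → ℂ} (hφ : ContinuousOn φ S)
    (hexp : ∀ x ∈ S, ∀ y ∈ S, Complex.exp (φ x) = Complex.exp (φ y)) {x y : X}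
    (hx : x ∈ S) (hy : y ∈ S) : φ x = φ y := by
  have hpi : (2 * Real.pi * Complex.I : ℂ) ≠ 0 := Complex.two_pi_I_ne_zero
  have hint : ∀ z ∈ S, ∃ n : ℤ, φ z = φ x + n * (2 * Real.pi * Complex.I) := fun z hz =>
    Complex.exp_eq_exp_iff_exists_int.1 (hexp z hz x hx)
  set ρ : X → ℝ := fun z => ((φ z - φ x) / (2 * Real.pi * Complex.I)).re with hρ
  have hρc : ContinuousOn ρ S :=
    Complex.continuous_re.comp_continuousOn ((hφ.sub continuousOn_const).div_const _)
  have hval : ∀ z (n : ℤ), φ z = φ x + n * (2 * Real.pi * Complex.I) → ρ z = n := by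
    intro z n h
    simp only [hρ, h, add_sub_cancel_left, mul_div_cancel_right₀ _ hpi, Complex.intCast_re]
  have hord := (hS.image ρ hρc).ordConnected
  obtain ⟨n, hn⟩ := hint y hy
  have hx0 : ρ x = 0 := by simp [hρ]
  have hy0 := hval y n hn
  -- The image of ρ is an interval consisting of integers; a nonzero n would put 1/2 or -1/2 in it.
  have half : ∀ r : ℝ, r ∈ uIcc (ρ x) (ρ y) → ∃ m : ℤ, r = m := by
    intro r hr
    obtain ⟨z, hz, rfl⟩ := hord.uIcc_subset (mem_image_of_mem _ hx) (mem_image_of_mem _ hy) hr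
    obtain ⟨m, hm⟩ := hint z hz
    exact ⟨m, hval z m hm⟩
  have hn0 : n = 0 := by
    by_contra hne
    rw [hx0, hy0] at half
    rcases lt_or_gt_of_ne hne with h | h
    · have h' : (n : ℝ) ≤ -1 := by exact_mod_cast Int.le_sub_one_of_lt h
      obtain ⟨m, hm⟩ := half (-1 / 2) (by rw [mem_uIcc]; right; constructor <;> linarith)
      have : (2 * m : ℝ) = -1 := by linarith
      have : 2 * m = -1 := by exact_mod_cast this
      omega
    · have h' : (1 : ℝ) ≤ n := by exact_mod_cast h
      obtain ⟨m, hm⟩ := half (1 / 2) (by rw [mem_uIcc]; left; constructor <;> linarith)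
      have : (2 * m : ℝ) = 1 := by linarith
      have : 2 * m = 1 := by exact_mod_cast this
      omega
  rw [hn, hn0]; simp

/-- Two points of a preconnected open set are not separated by its complement, so that the quotient
of the differences to them has a continuous logarithm there. -/
theorem IsPreconnected.exists_log_div_sub {N : Set ℂ} (hN : IsOpen N) (hc : IsPreconnected N)
    {b b' : ℂ} (hb : b ∈ N) (hb' : b' ∈ N) :
    ∃ L : ℂ → ℂ, ContinuousOn L Nᶜ ∧ ∀ z ∈ Nᶜ, Complex.exp (L z) = (z - b) / (z - b') := by
  have hne : ∀ {x z : ℂ}, x ∈ N → z ∈ Nᶜ → z - x ≠ 0 := by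
    intro x z hx hz h
    exact hz (sub_eq_zero.1 h ▸ hx)
  -- Having a logarithm of the quotient is an equivalence relation on N, so it suffices to verify it
  -- for nearby points.
  have hP := hc.induction₂ (fun x y => x ∈ N → y ∈ N → ∃ L : ℂ → ℂ, ContinuousOn L Nᶜ ∧
    ∀ z ∈ Nᶜ, Complex.exp (L z) = (z - x) / (z - y)) ?_ ?_ ?_ hb hb'
  · exact hP hb hb'
  · intro x hx
    obtain ⟨r, hr, hball⟩ := Metric.isOpen_iff.1 hN x hx
    filter_upwards [mem_nhdsWithin_of_mem_nhds (Metric.ball_mem_nhds x hr)] with y hy _ hyN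
    have hslit : ∀ z ∈ Nᶜ, (z - y) / (z - x) ∈ Complex.slitPlane := by
      intro z hz
      have hzx := hne hx hz
      have hzr : r ≤ ‖z - x‖ := by
        by_contra! h
        exact hz (hball (by rwa [Metric.mem_ball, dist_eq_norm]))
      have hyr : ‖y - x‖ < r := by rwa [Metric.mem_ball, dist_eq_norm] at hy
      have hlt : ‖(y - x) / (z - x)‖ < 1 := by
        rw [norm_div, div_lt_one (norm_pos_iff.2 hzx)]
        exact hyr.trans_le hzr
      have heq : (z - y) / (z - x) = 1 - (y - x) / (z - x) := by
        field_simp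
        ring
      rw [heq]
      left
      have := (Complex.re_le_norm ((y - x) / (z - x)))
      simp only [Complex.sub_re, Complex.one_re]
      linarith
    -- The inverse quotient is used because it lies within distance 1 of 1: only |z - x| is bounded
    -- below, by the radius of the ball.
    refine ⟨fun z => -Complex.log ((z - y) / (z - x)), ?_, ?_⟩
    · refine (ContinuousOn.clog ?_ hslit).neg
      exact (continuousOn_id.sub continuousOn_const).div (continuousOn_id.sub continuousOn_const)
        fun z hz => hne hx hz
    · intro z hz
      rw [Complex.exp_neg, Complex.exp_log (Complex.slitPlane_ne_zero (hslit z hz)), inv_div]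
  · intro x y w _ hy _ hxy hyw hx hw
    obtain ⟨L, hL, hL'⟩ := hxy hx hy
    obtain ⟨M, hM, hM'⟩ := hyw hy hw
    refine ⟨fun z => L z + M z, hL.add hM, fun z hz => ?_⟩
    rw [Complex.exp_add, hL' z hz, hM' z hz, div_mul_div_cancel₀ (hne hy hz)]
  · intro x y _ _ hxy hy hx
    obtain ⟨L, hL, hL'⟩ := hxy hx hy
    refine ⟨fun z => -L z, hL.neg, fun z hz => ?_⟩
    rw [Complex.exp_neg, hL' z hz, inv_div]

/-- Disjoint connected sets cannot join the two pairs of opposite ends of a cross. -/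
theorem not_disjoint_of_cross {P N : Set ℂ} (hN : IsOpen N) (hNc : IsPreconnected N)
    (hPc : IsPreconnected P) (hN1 : (1 : ℂ) ∈ N) (hN2 : (-1 : ℂ) ∈ N)
    (hP1 : Complex.I ∈ P) (hP2 : -Complex.I ∈ P)
    (hNP : ∀ t ∈ Icc (-1 : ℝ) 1, (t : ℂ) ∉ P)
    (hPN : ∀ t ∈ Icc (-1 : ℝ) 1, (t : ℂ) * Complex.I ∉ N) : ¬ Disjoint P N := by
  intro hd
  have hPsub : P ⊆ Nᶜ := hd.subset_compl_right
  -- L is compared with two branches: the principal one on P, and on the imaginary segment the one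
  -- cut along the positive axis. They give L(i) - L(-i) the values πi and -πi.
  obtain ⟨L, hL, hLexp⟩ := hNc.exists_log_div_sub hN hN1 hN2
  have hne1 : ∀ z ∈ Nᶜ, z - 1 ≠ 0 := fun z hz h => hz (sub_eq_zero.1 h ▸ hN1)
  have hne2 : ∀ z ∈ Nᶜ, z - -1 ≠ 0 := fun z hz h => hz (sub_eq_zero.1 h ▸ hN2)
  have hwc : ContinuousOn (fun z : ℂ => (z - 1) / (z - -1)) Nᶜ :=
    (continuousOn_id.sub continuousOn_const).div (continuousOn_id.sub continuousOn_const) hne2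
  have hslit : ∀ z ∈ P, (z - 1) / (z - -1) ∈ Complex.slitPlane := by
    intro z hz
    by_contra hs
    rw [Complex.mem_slitPlane_iff_not_le_zero, not_not, Complex.nonpos_iff] at hs
    obtain ⟨hre, him⟩ := hs
    set s : ℝ := -((z - 1) / (z - -1)).re with hsdef
    have hw : (z - 1) / (z - -1) = ((-s : ℝ) : ℂ) := by
      apply Complex.ext
      · simp [hsdef]
      · rw [him, Complex.ofReal_im]
    have hs0 : 0 ≤ s := by simp only [hsdef]; linarith
    have hs1 : (1 + s : ℝ) ≠ 0 := by positivity
    have hs2 : (1 + s : ℂ) ≠ 0 := by exact_mod_cast hs1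
    rw [div_eq_iff (hne2 z (hPsub hz))] at hw
    -- The Möbius map sends only points of [-1, 1] to the nonpositive reals, and P avoids that
    -- segment.
    have hz' : z = (((1 - s) / (1 + s) : ℝ) : ℂ) := by
      push_cast at hw ⊢
      rw [eq_div_iff hs2]
      linear_combination hw
    refine hNP ((1 - s) / (1 + s)) ⟨?_, ?_⟩ (hz' ▸ hz)
    · rw [le_div_iff₀ (by positivity)]; linarith
    · rw [div_le_one (by positivity)]; linarith
  have key1 : L Complex.I - Complex.log ((Complex.I - 1) / (Complex.I - -1)) =
      L (-Complex.I) - Complex.log ((-Complex.I - 1) / (-Complex.I - -1)) := by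
    refine hPc.eq_of_exp_eq (φ := fun z => L z - Complex.log ((z - 1) / (z - -1)))
      ((hL.mono hPsub).sub ((hwc.mono hPsub).clog hslit)) ?_ hP1 hP2
    have : ∀ z ∈ P, Complex.exp (L z - Complex.log ((z - 1) / (z - -1))) = 1 := by
      intro z hz
      have h0 := Complex.slitPlane_ne_zero (hslit z hz)
      rw [Complex.exp_sub, hLexp z (hPsub hz), Complex.exp_log h0, div_self h0]
    intro x hx y hy
    rw [this x hx, this y hy]
  set J : Set ℂ := (fun t : ℝ => (t : ℂ) * Complex.I) '' Icc (-1) 1 with hJ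
  have hJc : IsPreconnected J :=
    isPreconnected_Icc.image _ (by fun_prop)
  have hJsub : J ⊆ Nᶜ := by
    rintro _ ⟨t, ht, rfl⟩
    exact hPN t ht
  have hslit' : ∀ z ∈ J, -((z - 1) / (z - -1)) ∈ Complex.slitPlane := by
    rintro z hz
    have hz2 := hne2 z (hJsub hz)
    obtain ⟨t, ht, rfl⟩ := hz
    by_contra hs
    rw [Complex.mem_slitPlane_iff_not_le_zero, not_not, Complex.nonpos_iff] at hs
    obtain ⟨hre, him⟩ := hs
    set s : ℝ := (((t : ℂ) * Complex.I - 1) / ((t : ℂ) * Complex.I - -1)).re with hsdef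
    have hw : ((t : ℂ) * Complex.I - 1) / ((t : ℂ) * Complex.I - -1) = (s : ℂ) := by
      apply Complex.ext
      · simp [hsdef]
      · rw [Complex.neg_im, neg_eq_zero] at him
        rw [him, Complex.ofReal_im]
    have hs0 : 0 ≤ s := by
      rw [Complex.neg_re] at hre
      linarith
    -- Real parts of it - 1 = s(it + 1) give s = -1.
    rw [div_eq_iff hz2] at hw
    have := congrArg Complex.re hw
    simp at this
    linarith
  have hIJ : Complex.I ∈ J := ⟨1, by simp, by simp⟩
  have hIJ' : -Complex.I ∈ J := ⟨-1, by simp, by simp⟩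
  have key2 : L Complex.I - Complex.log (-((Complex.I - 1) / (Complex.I - -1))) =
      L (-Complex.I) - Complex.log (-((-Complex.I - 1) / (-Complex.I - -1))) := by
    refine hJc.eq_of_exp_eq (φ := fun z => L z - Complex.log (-((z - 1) / (z - -1))))
      ((hL.mono hJsub).sub ((hwc.mono hJsub).neg.clog hslit')) ?_ hIJ hIJ'
    have : ∀ z ∈ J, Complex.exp (L z - Complex.log (-((z - 1) / (z - -1)))) = -1 := by
      intro z hz
      have h0 := Complex.slitPlane_ne_zero (hslit' z hz)
      rw [Complex.exp_sub, hLexp z (hJsub hz), Complex.exp_log h0, div_neg,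
        div_self (neg_ne_zero.1 h0)]
    intro x hx y hy
    rw [this x hx, this y hy]
  have e1 : (Complex.I - 1) / (Complex.I - -1) = Complex.I := by
    rw [div_eq_iff (hne2 _ (hJsub hIJ))]
    linear_combination -Complex.I_sq
  have e2 : (-Complex.I - 1) / (-Complex.I - -1) = -Complex.I := by
    rw [div_eq_iff (hne2 _ (hJsub hIJ'))]
    linear_combination -Complex.I_sq
  rw [e1, e2, Complex.log_I, Complex.log_neg_I] at key1
  rw [e1, e2, neg_neg, Complex.log_I, Complex.log_neg_I] at key2
  have h0 : (2 * Real.pi * Complex.I : ℂ) = 0 := by linear_combination key2 - key1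
  exact Complex.two_pi_I_ne_zero h0

/-! ### Second derivatives and local maxima -/

/-- A strict second derivative test: where the second derivative in a direction is positive, the
function lies above its tangent along that direction. -/
theorem eventually_tangent_lt {f : Plane → ℝ} (hf : ContDiff ℝ 2 f) {q v : Plane}
    (h : 0 < fderiv ℝ (fderiv ℝ f) q v v) :
    ∀ᶠ t : ℝ in 𝓝[≠] 0, f q + t * fderiv ℝ f q v < f (q + t • v) := by
  have hline : ∀ t : ℝ, HasDerivAt (fun t : ℝ => q + t • v) v t := fun t => by
    simpa using ((hasDerivAt_id t).smul_const v).const_add q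
  have hd1 : Differentiable ℝ f := hf.differentiable (by norm_num)
  have hd2 : Differentiable ℝ (fderiv ℝ f) :=
    (hf.fderiv_right (m := 1) (by norm_num)).differentiable (by norm_num)
  have hφ : ∀ t : ℝ, HasDerivAt (fun t : ℝ => f (q + t • v) - t * fderiv ℝ f q v)
      (fderiv ℝ f (q + t • v) v - fderiv ℝ f q v) t := fun t => by
    have h1 := (hd1 (q + t • v)).hasFDerivAt.comp_hasDerivAt t (hline t)
    have h2 := h1.sub ((hasDerivAt_id t).mul_const (fderiv ℝ f q v))
    rw [one_mul] at h2
    exact h2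
  have hφ' : HasDerivAt (fun t : ℝ => fderiv ℝ f (q + t • v) v - fderiv ℝ f q v)
      (fderiv ℝ (fderiv ℝ f) q v v) 0 := by
    have h1 := (hd2 (q + (0 : ℝ) • v)).hasFDerivAt.comp_hasDerivAt 0 (hline 0)
    have h2 := (h1.clm_apply (hasDerivAt_const 0 v)).sub_const (fderiv ℝ f q v)
    simpa using h2
  have hsign := eventually_nhdsWithin_sign_eq_of_deriv_pos
    (f := fun t : ℝ => fderiv ℝ f (q + t • v) v - fderiv ℝ f q v) (x₀ := 0)
    (by rw [hφ'.deriv]; exact h) (by simp)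
  obtain ⟨ε, hε, hball⟩ := Metric.eventually_nhds_iff.1 hsign
  have key : ∀ t : ℝ, |t| < ε → t ≠ 0 → f q + t * fderiv ℝ f q v < f (q + t • v) := by
    intro t ht ht0
    -- By the mean value theorem, the difference from the tangent at t has the sign of t times its
    -- derivative at a point s between 0 and t.
    rcases lt_or_gt_of_ne ht0 with hneg | hpos
    · obtain ⟨s, hs, hs'⟩ := exists_hasDerivAt_eq_slope _ _ hneg
        (fun x _ => (hφ x).continuousAt.continuousWithinAt) (fun x _ => hφ x)
      have := hball (y := s) (by
        rw [Real.dist_eq, sub_zero, abs_of_neg hs.2]; rw [abs_of_neg hneg] at ht; linarith [hs.1])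
      rw [sub_zero, sign_neg hs.2, sign_eq_neg_one_iff, hs', div_neg_iff] at this
      simp only [zero_smul, add_zero, zero_mul, sub_zero] at this
      rcases this with h' | h'
      · linarith
      · linarith
    · obtain ⟨s, hs, hs'⟩ := exists_hasDerivAt_eq_slope _ _ hpos
        (fun x _ => (hφ x).continuousAt.continuousWithinAt) (fun x _ => hφ x)
      have := hball (y := s) (by
        rw [Real.dist_eq, sub_zero, abs_of_pos hs.1]; rw [abs_of_pos hpos] at ht; linarith [hs.2])
      rw [sub_zero, sign_pos hs.1, sign_eq_one_iff, hs', div_pos_iff] at this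
      simp only [zero_smul, add_zero, zero_mul, sub_zero] at this
      rcases this with h' | h'
      · linarith
      · linarith
  rw [eventually_nhdsWithin_iff]
  filter_upwards [Metric.ball_mem_nhds (0 : ℝ) hε] with t ht ht0
  exact key t (by simpa [Real.dist_eq] using ht) ht0

/-- Where the second derivative is positive in some direction, no affine perturbation has a local
maximum. -/
theorem not_isLocalMax_sub_linear {f : Plane → ℝ} (hf : ContDiff ℝ 2 f) {q v : Plane}
    (h : 0 < fderiv ℝ (fderiv ℝ f) q v v) (l : Plane →L[ℝ] ℝ) :
    ¬ IsLocalMax (fun z => f z - l z) q := by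
  intro hmax
  have hd : HasFDerivAt (fun z => f z - l z) (fderiv ℝ f q - l) q :=
    (hf.differentiable (by norm_num) q).hasFDerivAt.sub l.hasFDerivAt
  have h0 := hmax.hasFDerivAt_eq_zero hd
  have hl : fderiv ℝ f q = l := sub_eq_zero.1 h0
  have hcont : Tendsto (fun t : ℝ => q + t • v) (𝓝[≠] 0) (𝓝 q) := by
    have : Continuous (fun t : ℝ => q + t • v) := by fun_prop
    have := this.tendsto 0
    rw [zero_smul, add_zero] at this
    exact this.mono_left nhdsWithin_le_nhds
  obtain ⟨t, ht1, ht2⟩ := ((eventually_tangent_lt hf h).and (hcont.eventually hmax)).exists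
  simp only [map_add, map_smul, smul_eq_mul] at ht2
  rw [hl] at ht1
  linarith

/-! ### Maximum principle in a strip -/

/-- A continuous function without local maxima up to linear terms, on a region of the plane
contained in a strip and such that the function is bounded there and nonpositive on the boundary,
does not increase from the maximum of a slice of the strip. -/
theorem not_gt_slice_max {u : Plane → ℝ} (hu : Continuous u)
    (hmax : ∀ (l : Plane →L[ℝ] ℝ) q, ¬ IsLocalMax (fun z => u z - l z) q)
    {Ω : Set Plane} (hΩ : IsOpen Ω) (hbd : ∀ z ∈ closure Ω, 0 < u z → z ∈ Ω)
    {a b : Plane →L[ℝ] ℝ} {A B : ℝ}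
    (hab : ∀ R : ℝ, Bornology.IsBounded {z | |a z| ≤ A ∧ |b z| ≤ R})
    (hA : ∀ z ∈ closure Ω, |a z| ≤ A) (hB : ∀ z ∈ closure Ω, u z ≤ B) {m β : ℝ} (hm : 0 < m)
    (hs : ∀ z ∈ closure Ω, b z = β → u z ≤ m) {p : Plane} (hp : p ∈ Ω) (hbp : β < b p) :
    u p ≤ m := by
  by_contra! hup
  -- With this slope, subtracting r(b - β) costs p only half of its excess over m.
  set r : ℝ := (u p - m) / (2 * (b p - β)) with hr
  have hbp' : 0 < b p - β := by linarith
  have hr0 : 0 < r := div_pos (by linarith) (by linarith)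
  have hrp : r * (b p - β) = (u p - m) / 2 := by
    rw [hr]; field_simp
  -- The cutoff makes K compact. The tilted function is at most m on the slice and at most 0 where
  -- r(b - β) = B, and u ≤ 0 on closure points outside Ω. Its maximum exceeds m, so it is interior.
  set K : Set Plane := closure Ω ∩ {z | β ≤ b z ∧ r * (b z - β) ≤ B} with hK
  have hKclosed : IsClosed K := by
    refine isClosed_closure.inter (IsClosed.inter ?_ ?_)
    · exact isClosed_le continuous_const b.continuous
    · exact isClosed_le (f := fun z => r * (b z - β)) (by fun_prop) continuous_const
  have hKc : IsCompact K := by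
    refine Metric.isCompact_of_isClosed_isBounded hKclosed
      ((hab (|β| + B / r)).subset ?_)
    rintro z ⟨hz, hz1, hz2⟩
    refine ⟨hA z hz, ?_⟩
    have h1 : b z - β ≤ B / r := by rw [le_div_iff₀ hr0]; linarith
    rw [abs_le]
    constructor <;> linarith [neg_abs_le β, le_abs_self β]
  have hpB := hB p (subset_closure hp)
  have hpK : p ∈ K := ⟨subset_closure hp, hbp.le, by rw [hrp]; linarith⟩
  obtain ⟨x, hxK, hx⟩ := hKc.exists_isMaxOn ⟨p, hpK⟩
    (f := fun z => u z - (r • b) z) (by fun_prop)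
  have hxp : u p - r * b p ≤ u x - r * b x := by simpa using hx hpK
  have hxm : m < u x - r * (b x - β) := by linarith
  obtain ⟨hxΩ, hx1, hx2⟩ := hxK
  have hrb : 0 ≤ r * (b x - β) := mul_nonneg hr0.le (by linarith)
  have hx1' : β < b x := by
    refine lt_of_le_of_ne hx1 fun h => ?_
    have := hs x hxΩ h.symm
    linarith
  have hx2' : r * (b x - β) < B := by
    have := hB x hxΩ
    linarith
  have hxΩ' : x ∈ Ω := hbd x hxΩ (by linarith)
  refine hmax (r • b) x (hx.isLocalMax ?_)
  have hopen : IsOpen (Ω ∩ ({z | β < b z} ∩ {z | r * (b z - β) < B})) :=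
    hΩ.inter ((isOpen_lt continuous_const b.continuous).inter
      (isOpen_lt (f := fun z => r * (b z - β)) (by fun_prop) continuous_const))
  refine mem_of_superset (hopen.mem_nhds ⟨hxΩ', hx1', hx2'⟩) ?_
  rintro z ⟨hz, hz1, hz2⟩
  exact ⟨subset_closure hz, le_of_lt hz1, le_of_lt hz2⟩

/-- There is no bounded positive saddle function on a region in a strip with zero boundary
values. -/
theorem nonpos_of_subset_strip {u : Plane → ℝ} (hu : Continuous u)
    (hmax : ∀ (l : Plane →L[ℝ] ℝ) q, ¬ IsLocalMax (fun z => u z - l z) q)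
    {Ω : Set Plane} (hΩ : IsOpen Ω) (hbd : ∀ z ∈ closure Ω, 0 < u z → z ∈ Ω)
    {a b : Plane →L[ℝ] ℝ} {A B : ℝ}
    (hab : ∀ R : ℝ, Bornology.IsBounded {z | |a z| ≤ A ∧ |b z| ≤ R})
    (hA : ∀ z ∈ Ω, |a z| ≤ A) (hB : ∀ z ∈ Ω, u z ≤ B) {q : Plane} (hq : q ∈ Ω) : u q ≤ 0 := by
  by_contra! huq
  have hA' : ∀ z ∈ closure Ω, |a z| ≤ A :=
    closure_minimal hA (isClosed_le a.continuous.abs continuous_const)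
  have hB' : ∀ z ∈ closure Ω, u z ≤ B :=
    closure_minimal hB (isClosed_le hu continuous_const)
  have hKc : IsCompact (closure Ω ∩ {z | b z = b q}) := by
    refine Metric.isCompact_of_isClosed_isBounded
      (isClosed_closure.inter (isClosed_eq b.continuous continuous_const))
      ((hab |b q|).subset ?_)
    rintro z ⟨hz, hz1⟩
    exact ⟨hA' z hz, (congrArg abs hz1).le⟩
  obtain ⟨p, ⟨hpΩ, hpb⟩, hp⟩ := hKc.exists_isMaxOn ⟨q, subset_closure hq, rfl⟩ hu.continuousOn
  have hpq : u q ≤ u p := hp ⟨subset_closure hq, rfl⟩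
  have hs : ∀ z ∈ closure Ω, b z = b q → u z ≤ u p := fun z hz hz1 => hp ⟨hz, hz1⟩
  have hpΩ' : p ∈ Ω := hbd p hpΩ (by linarith)
  -- Applying the slice bound with b and with -b makes the slice maximum p a maximum over all of Ω.
  refine hmax 0 p ?_
  filter_upwards [hΩ.mem_nhds hpΩ'] with z hz
  simp only [zero_apply, sub_zero]
  rcases lt_trichotomy (b z) (b q) with h | h | h
  · refine not_gt_slice_max (b := -b) (β := -b q) hu hmax hΩ hbd ?_ hA' hB' (by linarith) ?_ hz ?_
    · simpa using hab
    · intro x hx hxb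
      exact hs x hx (by simpa using hxb)
    · simpa using h
  · exact hs z (subset_closure hz) h
  · exact not_gt_slice_max hu hmax hΩ hbd hab hA' hB' (by linarith) hs hz h

/-- A nonzero linear functional on the plane can be completed to proper linear coordinates. -/
theorem exists_complementary_functional {a : Plane →L[ℝ] ℝ} (ha : a ≠ 0) :
    ∃ b : Plane →L[ℝ] ℝ, ∀ A R : ℝ, Bornology.IsBounded {z | |a z| ≤ A ∧ |b z| ≤ R} := by
  set x := a (EuclideanSpace.single 0 1) with hx
  set y := a (EuclideanSpace.single 1 1) with hy
  have haz : ∀ z, a z = z 0 * x + z 1 * y := by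
    intro z
    have hz : z = z 0 • EuclideanSpace.single 0 1 + z 1 • EuclideanSpace.single 1 1 := by
      ext i; fin_cases i <;> simp
    conv_lhs => rw [hz]
    simp [hx, hy]
  have hxy : 0 < x ^ 2 + y ^ 2 := by
    by_contra! h
    have hx0 : x = 0 := by nlinarith [sq_nonneg x, sq_nonneg y]
    have hy0 : y = 0 := by nlinarith [sq_nonneg x, sq_nonneg y]
    exact ha (by ext z; simp [haz, hx0, hy0])
  -- This is a rotated by a right angle, so a² + b² = (x² + y²)|z|².
  refine ⟨x • EuclideanSpace.proj 1 - y • EuclideanSpace.proj 0, fun A R => ?_⟩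
  refine (Metric.isBounded_closedBall (x := (0 : Plane))
    (r := √((A ^ 2 + R ^ 2) / (x ^ 2 + y ^ 2)))).subset ?_
  rintro z ⟨h1, h2⟩
  rw [mem_closedBall_zero_iff]
  refine Real.le_sqrt_of_sq_le ?_
  rw [le_div_iff₀ hxy, EuclideanSpace.norm_sq_eq, Fin.sum_univ_two]
  simp only [Real.norm_eq_abs, sq_abs]
  have h1' := sq_le_sq' (abs_le.1 h1).1 (abs_le.1 h1).2
  have h2' := sq_le_sq' (abs_le.1 h2).1 (abs_le.1 h2).2
  rw [haz] at h1'
  change (x * z 1 - y * z 0) ^ 2 ≤ R ^ 2 at h2'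
  nlinarith

/-! ### Connected sign sets and the contradiction -/

/-- A bounded saddle function is positive relative to a nonconstant affine function on a connected
set. -/
theorem isPreconnected_pos_sub_affine {f : Plane → ℝ} (hf : Continuous f)
    (hmax : ∀ (l : Plane →L[ℝ] ℝ) q, ¬ IsLocalMax (fun z => f z - l z) q)
    {C : ℝ} (hC : ∀ q, |f q| ≤ C) {a : Plane →L[ℝ] ℝ} (ha : a ≠ 0) (c : ℝ) :
    IsPreconnected {z | 0 < f z - a z - c} := by
  obtain ⟨b, hab⟩ := exists_complementary_functional ha
  set P : Set Plane := {z | 0 < f z - a z - c} with hP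
  set H : Set Plane := {z | a z < -C - c} with hH
  have hPo : IsOpen P := isOpen_lt continuous_const (by fun_prop)
  have hHP : H ⊆ P := fun z hz => by
    have h1 : a z < -C - c := hz
    have h2 := (abs_le.1 (hC z)).1
    change 0 < f z - a z - c
    linarith
  have hHc : IsPreconnected H :=
    ((convex_Iio (-C - c)).linear_preimage a.toLinearMap).isPreconnected
  have hmeet : ∀ q ∈ P, (connectedComponentIn P q ∩ H).Nonempty := by
    intro q hq
    by_contra hne
    have hdisj : ∀ z ∈ connectedComponentIn P q, -C - c ≤ a z := by
      intro z hz
      by_contra! h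
      exact hne ⟨z, hz, h⟩
    have hupper : ∀ z ∈ connectedComponentIn P q, a z ≤ C - c := by
      intro z hz
      have h1 : 0 < f z - a z - c := connectedComponentIn_subset P q hz
      have h2 := (abs_le.1 (hC z)).2
      linarith
    -- Off H one has -a - c ≤ C, hence the upper bound 2C; positivity gives a ≤ C - c, hence the
    -- width C + |c|.
    have := nonpos_of_subset_strip (u := fun z => f z - a z - c) (a := a) (b := b)
      (Ω := connectedComponentIn P q) (A := C + |c|) (B := 2 * C) (by fun_prop) ?_
      hPo.connectedComponentIn ?_ (hab _) ?_ ?_ (mem_connectedComponentIn hq)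
    · have h1 : 0 < f q - a q - c := hq
      linarith
    · intro l z hz
      refine hmax (a + l) z ?_
      filter_upwards [hz] with w hw
      simp only [add_apply]
      linarith
    · intro z hz hpos
      -- Adding a closure point keeps the component connected, so one where the function is positive
      -- already belongs to it.
      have hsub : insert z (connectedComponentIn P q) ⊆ connectedComponentIn P q := by
        refine IsPreconnected.subset_connectedComponentIn
          (isPreconnected_connectedComponentIn.subset_closure (subset_insert _ _)
            (insert_subset hz subset_closure))
          (mem_insert_of_mem _ (mem_connectedComponentIn hq))
          (insert_subset hpos (connectedComponentIn_subset _ _))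
      exact hsub (mem_insert _ _)
    · intro z hz
      have h1 := hdisj z hz
      have h2 := hupper z hz
      rw [abs_le]
      constructor <;> linarith [neg_abs_le c, le_abs_self c]
    · intro z hz
      have h1 := hdisj z hz
      have h2 := (abs_le.1 (hC z)).2
      linarith
  refine isPreconnected_of_forall_pair fun x hx y hy => ?_
  obtain ⟨x', hx1, hx2⟩ := hmeet x hx
  obtain ⟨y', hy1, hy2⟩ := hmeet y hy
  refine ⟨connectedComponentIn P x ∪ H ∪ connectedComponentIn P y, ?_, ?_, ?_, ?_⟩
  · exact union_subset (union_subset (connectedComponentIn_subset _ _) hHP)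
      (connectedComponentIn_subset _ _)
  · exact Or.inl (Or.inl (mem_connectedComponentIn hx))
  · exact Or.inr (mem_connectedComponentIn hy)
  · exact IsPreconnected.union y' (Or.inr hy2) hy1
      (IsPreconnected.union x' hx1 hx2 isPreconnected_connectedComponentIn hHc)
      isPreconnected_connectedComponentIn

/-- There is no bounded function on the plane with indefinite second derivative everywhere. -/
theorem not_bounded_of_indefinite {f : Plane → ℝ} (hf : ContDiff ℝ 2 f)
    (hpos : ∀ q, ∃ u, 0 < fderiv ℝ (fderiv ℝ f) q u u)
    (hneg : ∀ q, ∃ v, fderiv ℝ (fderiv ℝ f) q v v < 0) {C : ℝ} : ¬ ∀ q, |f q| ≤ C := by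
  intro hC
  obtain ⟨q, hq⟩ : ∃ q, fderiv ℝ f q ≠ 0 := by
    by_contra! h
    obtain ⟨u, hu⟩ := hpos 0
    have : fderiv ℝ f = fun _ => 0 := funext h
    rw [this] at hu
    simp at hu
  set a := fderiv ℝ f q with ha
  set c := f q - a q with hc
  have hf' : ContDiff ℝ 2 (fun z => -f z) := hf.neg
  have hD : ∀ z v, fderiv ℝ (fderiv ℝ fun z => -f z) z v v = -fderiv ℝ (fderiv ℝ f) z v v := by
    intro z v
    have h1 : (fderiv ℝ fun z => -f z) = fun z => -fderiv ℝ f z := funext fun z => fderiv_fun_neg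
    rw [h1, fderiv_fun_neg]
    rfl
  have hP : IsPreconnected {z | 0 < f z - a z - c} :=
    isPreconnected_pos_sub_affine hf.continuous
      (fun l z => (hpos z).elim fun u hu => not_isLocalMax_sub_linear hf hu l) hC hq c
  have hN : IsPreconnected {z | f z - a z - c < 0} := by
    have := isPreconnected_pos_sub_affine (f := fun z => -f z) (a := -a) (C := C) hf'.continuous
      (fun l z => (hneg z).elim fun v hv => not_isLocalMax_sub_linear hf' (v := v)
        (by rw [hD]; linarith) l) (by simpa using hC) (neg_ne_zero.2 hq) (-c)
    convert this using 2
    ext z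
    rw [neg_apply]
    constructor <;> intro h <;> linarith
  obtain ⟨u, hu⟩ := hpos q
  obtain ⟨v, hv⟩ := hneg q
  have hu' := eventually_tangent_lt hf hu
  have hv' := eventually_tangent_lt hf' (v := v) (by rw [hD]; linarith)
  obtain ⟨ε, hε, hball⟩ := Metric.eventually_nhds_iff.1
    (eventually_nhdsWithin_iff.1 (hu'.and hv'))
  have hδ : 0 < ε / 2 := by linarith
  set δ := ε / 2 with hδ'
  have hscale : ∀ t : ℝ, t ∈ Icc (-1 : ℝ) 1 → t ≠ 0 →
      0 < f (q + (t * δ) • u) - a (q + (t * δ) • u) - c ∧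
      f (q + (t * δ) • v) - a (q + (t * δ) • v) - c < 0 := by
    intro t ht ht0
    have h1 : dist (t * δ) 0 < ε := by
      rw [Real.dist_eq, sub_zero, abs_mul, abs_of_pos hδ]
      have := abs_le.2 ht
      nlinarith
    obtain ⟨h2, h3⟩ := hball h1 (mul_ne_zero ht0 hδ.ne')
    rw [fderiv_fun_neg, neg_apply] at h3
    simp only [map_add, map_smul, smul_eq_mul, hc]
    constructor <;> linarith
  -- Affine coordinates at q carry the real axis to the direction v and the imaginary axis to u,
  -- scaled so that the unit cross stays where the signs are known.
  set T : ℂ →ₗ[ℝ] Plane :=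
    Complex.reLm.smulRight (δ • v) + Complex.imLm.smulRight (δ • u) with hT
  have hTz : ∀ z : ℂ, T z = (z.re * δ) • v + (z.im * δ) • u := by
    intro z
    simp [hT, smul_smul]
  have hTinj : Function.Injective T := by
    rw [← LinearMap.ker_eq_bot, LinearMap.ker_eq_bot']
    intro z hz
    rw [hTz] at hz
    have him : z.im = 0 := by
      by_contra him
      have him' : z.im * δ ≠ 0 := mul_ne_zero him hδ.ne'
      have huv : u = (-(z.re * δ) / (z.im * δ)) • v := by
        have : (z.im * δ) • u = (-(z.re * δ)) • v := by
          rw [neg_smul]; exact eq_neg_of_add_eq_zero_right hz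
        rw [div_eq_inv_mul, mul_smul, ← this, smul_smul, inv_mul_cancel₀ him', one_smul]
      rw [huv] at hu
      -- If u were a multiple of v, the second derivative along u would be a square times the
      -- negative one along v.
      simp only [map_smul, smul_apply, smul_eq_mul] at hu
      nlinarith [mul_self_nonneg (-(z.re * δ) / (z.im * δ))]
    have hre : z.re = 0 := by
      by_contra hre
      rw [him, zero_mul, zero_smul, add_zero, smul_eq_zero] at hz
      have hv0 : v = 0 := hz.resolve_left (mul_ne_zero hre hδ.ne')
      rw [hv0] at hv
      simp at hv
    exact Complex.ext hre him
  set e : ℂ ≃ₜ Plane := (LinearEquiv.ofInjectiveOfFinrankEq T hTinj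
    (by simp [Complex.finrank_real_complex])).toContinuousLinearEquiv.toHomeomorph.trans
      (Homeomorph.addLeft q) with he
  have hez : ∀ z, e z = q + T z := fun z => rfl
  have hPe : IsPreconnected (e ⁻¹' {z | 0 < f z - a z - c}) := e.isPreconnected_preimage.2 hP
  have hNe : IsPreconnected (e ⁻¹' {z | f z - a z - c < 0}) := e.isPreconnected_preimage.2 hN
  have hNo : IsOpen (e ⁻¹' {z | f z - a z - c < 0}) := by
    refine (isOpen_lt (f := fun z => f z - a z - c) ?_ continuous_const).preimage e.continuous
    have := hf.continuous
    fun_prop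
  have hre : ∀ t : ℝ, e t = q + (t * δ) • v := fun t => by simp [hez, hTz]
  have him : ∀ t : ℝ, e (t * Complex.I) = q + (t * δ) • u := fun t => by simp [hez, hTz]
  have hq0 : f q - a q - c = 0 := by rw [hc]; ring
  refine not_disjoint_of_cross hNo hNe hPe ?_ ?_ ?_ ?_ ?_ ?_ ?_
  · have := (hscale 1 (by simp) one_ne_zero).2
    rw [← hre] at this
    simpa using this
  · have := (hscale (-1) (by simp) (by norm_num)).2
    rw [← hre] at this
    simpa using this
  · have := (hscale 1 (by simp) one_ne_zero).1
    rw [← him] at this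
    simpa using this
  · have := (hscale (-1) (by simp) (by norm_num)).1
    rw [← him] at this
    simpa using this
  · intro t ht h
    change 0 < f (e t) - a (e t) - c at h
    rw [hre] at h
    rcases eq_or_ne t 0 with rfl | h0
    · rw [zero_mul, zero_smul, add_zero, hq0] at h
      exact lt_irrefl _ h
    · exact lt_asymm h (hscale t ht h0).2
  · intro t ht h
    change f (e (t * Complex.I)) - a (e (t * Complex.I)) - c < 0 at h
    rw [him] at h
    rcases eq_or_ne t 0 with rfl | h0
    · rw [zero_mul, zero_smul, add_zero, hq0] at h
      exact lt_irrefl _ h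
    · exact lt_asymm h (hscale t ht h0).1
  · rw [Set.disjoint_left]
    intro z h1 h2
    exact lt_asymm (show 0 < f (e z) - a (e z) - c from h1) h2

/-! ### From Gauss curvature to the second derivative of f -/

/-- The second derivative of `f` in the direction of the projection of a tangent vector is
proportional to the corresponding second derivative in tangent-normal coordinates. -/
theorem exists_fderiv_fderiv_eq_mul_hessianMatrix {f : Plane → ℝ} (hf : ContDiff ℝ ∞ f) {p : Space}
    (hp : p ∈ graphSurface f) {e : OrthonormalBasis (Fin 3) ℝ Space} {V : Set Plane}
    {h : Plane → ℝ} (hg : IsTangentNormalGraph (graphSurface f) p e V h) :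
    ∃ c : ℝ, c ≠ 0 ∧ ∀ i, ∃ w, fderiv ℝ (fderiv ℝ f) !₂[p 0, p 1] w w =
      c * hessianMatrix h 0 i i := by
  obtain ⟨⟨hV, hh, U, hU, hUS⟩, h0V, hh0, hdh0⟩ := hg
  set proj : Space →L[ℝ] Plane :=
    (EuclideanSpace.proj 0).smulRight (EuclideanSpace.single 0 1) +
    (EuclideanSpace.proj 1).smulRight (EuclideanSpace.single 1 1) with hproj
  have hprojP : ∀ P : Space, proj P = !₂[P 0, P 1] := by
    intro P
    ext i
    fin_cases i <;> simp [hproj]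
  rw [← hprojP p]
  set q := proj p with hq
  have hpq : p 2 = f q := by rw [hq, hprojP]; exact hp
  have hmem : ∀ x ∈ V, coordPoint p e x (h x) ∈ graphSurface f := by
    intro x hx
    have : coordPoint p e x (h x) ∈ U ∩ graphSurface f := by
      rw [hUS]
      exact mem_image_of_mem _ hx
    exact this.2
  have hd1 : Differentiable ℝ f := hf.differentiable (by simp)
  have hd2 : Differentiable ℝ (fderiv ℝ f) :=
    (hf.fderiv_right (m := 1) (WithTop.coe_le_coe.2 le_top)).differentiable (by norm_num)
  have hhd : ∀ x ∈ V, ContDiffAt ℝ ∞ h x := fun x hx => hh.contDiffAt (hV.mem_nhds hx)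
  have hhd2 : DifferentiableAt ℝ (fderiv ℝ h) 0 :=
    ((hhd 0 h0V).fderiv_right (m := 1) (WithTop.coe_le_coe.2 le_top)).differentiableAt (by norm_num)
  have hline : ∀ (i : Fin 2) (t : ℝ), HasDerivAt (fun t : ℝ => t • (EuclideanSpace.single i 1 : Plane))
      (EuclideanSpace.single i 1) t := fun i t => by
    simpa using (hasDerivAt_id t).smul_const (EuclideanSpace.single i (1 : ℝ) : Plane)
  have hlineV : ∀ i : Fin 2, ∀ᶠ t : ℝ in 𝓝 0, t • (EuclideanSpace.single i 1 : Plane) ∈ V := by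
    intro i
    refine (hline i 0).continuousAt.eventually_mem ?_
    rw [zero_smul]
    exact hV.mem_nhds h0V
  have key : ∀ i : Fin 2, fderiv ℝ f q (proj (e i.castSucc)) = e i.castSucc 2 ∧
      fderiv ℝ (fderiv ℝ f) q (proj (e i.castSucc)) (proj (e i.castSucc)) =
        (e 2 2 - fderiv ℝ f q (proj (e 2))) * hessianMatrix h 0 i i := by
    intro i
    set s : Plane := EuclideanSpace.single i 1 with hs
    set w := proj (e i.castSucc) with hw
    set n := proj (e 2) with hn
    -- This is the shadow in the base plane of the surface curve over the i-th tangent axis. Along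
    -- it f equals the height of the curve, and that identity is differentiated twice.
    set r : ℝ → Plane := fun t => q + t • w + h (t • s) • n with hr
    have hψ : ∀ t : ℝ, t • s ∈ V → HasDerivAt (fun t : ℝ => h (t • s)) (partialDeriv i h (t • s)) t :=
      fun t ht => ((hhd _ ht).differentiableAt (by simp)).hasFDerivAt.comp_hasDerivAt t (hline i t)
    have hr' : ∀ t : ℝ, t • s ∈ V → HasDerivAt r (w + partialDeriv i h (t • s) • n) t := by
      intro t ht
      have h1 : HasDerivAt (fun t : ℝ => q + t • w) w t := by
        simpa using ((hasDerivAt_id t).smul_const w).const_add q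
      exact h1.add ((hψ t ht).smul_const n)
    have hcoord : ∀ t : ℝ, coordPoint p e (t • s) (h (t • s)) =
        p + t • e i.castSucc + h (t • s) • e 2 := by
      intro t
      fin_cases i <;> simp [coordPoint, hs]
    have hval : ∀ t : ℝ, t • s ∈ V →
        f (r t) = p 2 + t * e i.castSucc 2 + h (t • s) * e 2 2 := by
      intro t ht
      have h1 := hmem _ ht
      have h2 : r t = proj (coordPoint p e (t • s) (h (t • s))) := by
        simp [hcoord, hr, hw, hn, hq]
      rw [h2, hprojP]
      have h3 : (coordPoint p e (t • s) (h (t • s))) 2 = _ := h1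
      rw [← h3, hcoord]
      simp
    -- The identity is needed on a neighbourhood, not only at 0, because it is differentiated again.
    have hfirst : ∀ᶠ t : ℝ in 𝓝 0, fderiv ℝ f (r t) (w + partialDeriv i h (t • s) • n) =
        e i.castSucc 2 + partialDeriv i h (t • s) * e 2 2 := by
      filter_upwards [hlineV i, (hlineV i).eventually_nhds] with t ht hnear
      have h1 := (hd1 (r t)).hasFDerivAt.comp_hasDerivAt t (hr' t ht)
      have h2 : HasDerivAt (fun t : ℝ => p 2 + t * e i.castSucc 2 + h (t • s) * e 2 2)
          (e i.castSucc 2 + partialDeriv i h (t • s) * e 2 2) t := by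
        have h3 : HasDerivAt (fun t : ℝ => p 2 + t * e i.castSucc 2) (e i.castSucc 2) t := by
          simpa using ((hasDerivAt_id t).mul_const (e i.castSucc 2)).const_add (p 2)
        exact h3.add ((hψ t ht).mul_const _)
      refine h1.unique (h2.congr_of_eventuallyEq ?_)
      filter_upwards [hnear] with x hx
      exact hval x hx
    have hψ0 : partialDeriv i h 0 = 0 := by simp [partialDeriv, hdh0]
    have hr0 : r 0 = q := by simp [hr, hh0]
    have h1 : fderiv ℝ f q w = e i.castSucc 2 := by
      have := hfirst.self_of_nhds
      simpa [hψ0, hr0] using this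
    refine ⟨h1, ?_⟩
    have hψ2 : HasDerivAt (fun t : ℝ => partialDeriv i h (t • s)) (hessianMatrix h 0 i i) 0 := by
      have hpd : DifferentiableAt ℝ (partialDeriv i h) ((0 : ℝ) • s) := by
        rw [zero_smul]
        exact hhd2.clm_apply (differentiableAt_const _)
      have := hpd.hasFDerivAt.comp_hasDerivAt (0 : ℝ) (hline i 0)
      rw [zero_smul] at this
      exact this
    have hL : HasDerivAt (fun t : ℝ => fderiv ℝ f (r t) (w + partialDeriv i h (t • s) • n))
        (fderiv ℝ (fderiv ℝ f) q w w + fderiv ℝ f q (hessianMatrix h 0 i i • n)) 0 := by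
      have h2 := (hd2 (r 0)).hasFDerivAt.comp_hasDerivAt 0 (hr' 0 (by simpa using h0V))
      have h3 := h2.clm_apply ((hψ2.smul_const n).const_add w)
      simpa [hψ0, hr0] using h3
    have hR : HasDerivAt (fun t : ℝ => e i.castSucc 2 + partialDeriv i h (t • s) * e 2 2)
        (hessianMatrix h 0 i i * e 2 2) 0 := (hψ2.mul_const _).const_add _
    have h4 := hL.unique (hR.congr_of_eventuallyEq hfirst)
    rw [map_smul, smul_eq_mul] at h4
    linear_combination h4
  refine ⟨e 2 2 - fderiv ℝ f q (proj (e 2)), ?_, fun i => ⟨_, (key i).2⟩⟩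
  intro hc
  -- If the factor vanished, the third coordinate would equal the derivative of f composed with
  -- `proj` on the whole basis, yet `proj` kills the vertical vector.
  have hzero : (EuclideanSpace.proj 2 : Space →L[ℝ] ℝ) = (fderiv ℝ f q).comp proj := by
    apply ContinuousLinearMap.coe_injective
    refine e.toBasis.ext fun k => ?_
    rw [e.coe_toBasis]
    change e k 2 = fderiv ℝ f q (proj (e k))
    fin_cases k
    · exact (key 0).1.symm
    · exact (key 1).1.symm
    · exact sub_eq_zero.1 hc
  have := congrArg (fun l : Space →L[ℝ] ℝ => l (EuclideanSpace.single 2 1)) hzero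
  simp [hproj] at this

theorem mainTheorem3 (f : Plane → ℝ) (hf : ContDiff ℝ ∞ f)
    (hsaddle : IsStrictlySaddle (graphSurface f)) :
    ¬ ∃ C : ℝ, ∀ q : Plane, |f q| ≤ C := by
  rintro ⟨C, hC⟩
  have hind : ∀ q, (∃ u, 0 < fderiv ℝ (fderiv ℝ f) q u u) ∧
      ∃ v, fderiv ℝ (fderiv ℝ f) q v v < 0 := by
    intro q
    have hq : !₂[q 0, q 1] = q := by
      ext i
      fin_cases i <;> simp
    have hp : (!₂[q 0, q 1, f q] : Space) ∈ graphSurface f := by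
      simp [graphSurface, hq]
    obtain ⟨K, ⟨k₁, k₂, ⟨hk, e, V, h, hg, hhess⟩, rfl⟩, hK⟩ := hsaddle.2 _ hp
    obtain ⟨c, hc, hw⟩ := exists_fderiv_fderiv_eq_mul_hessianMatrix hf hp hg
    obtain ⟨w₁, hw₁⟩ := hw 0
    obtain ⟨w₂, hw₂⟩ := hw 1
    simp only [hhess, Matrix.diagonal_apply_eq, Matrix.cons_val_zero, Matrix.cons_val_one] at hw₁ hw₂
    change fderiv ℝ (fderiv ℝ f) !₂[q 0, q 1] w₁ w₁ = _ at hw₁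
    change fderiv ℝ (fderiv ℝ f) !₂[q 0, q 1] w₂ w₂ = _ at hw₂
    rw [hq] at hw₁ hw₂
    have hk₁ : k₁ < 0 := by
      by_contra! h1
      exact absurd (mul_nonneg h1 (h1.trans hk)) (not_le.2 hK)
    have hk₂ : 0 < k₂ := by
      by_contra! h1
      exact absurd (mul_nonneg_of_nonpos_of_nonpos hk₁.le h1) (not_le.2 hK)
    -- The sign of c reflects the choice of normal and only exchanges the two directions.
    rcases lt_or_gt_of_ne hc with h1 | h1
    · exact ⟨⟨w₁, hw₁ ▸ mul_pos_of_neg_of_neg h1 hk₁⟩, w₂, hw₂ ▸ mul_neg_of_neg_of_pos h1 hk₂⟩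
    · exact ⟨⟨w₂, hw₂ ▸ mul_pos h1 hk₂⟩, w₁, hw₁ ▸ mul_neg_of_pos_of_neg h1 hk₁⟩
  exact not_bounded_of_indefinite (hf.of_le (WithTop.coe_le_coe.2 le_top)) (fun q => (hind q).1)
    (fun q => (hind q).2) hC
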